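/- **Setting.** Fix a message language, that is, an arbitrary signature of function symbols with arities, and an arbitrary equational theory $=_E$ on messages $M,N,K$ built from variables (the least congruence containing all substitution instances of a set of axioms). Names are variables. Processes and extended processes (in normal form) are, up to $\alpha$-conversion, $$P,Q ::= 0 \mid \overline{M}\langle N\rangle.P \mid M(y).P \mid [M=N]P \mid [M\neq N]P \mid \nu x.P \mid P\,|\,Q \mid P+Q \mid\; !P,\qquad A,B ::= \sigma\,|\,P \mid \nu x.A,$$ where in $\nu\vec x.(\sigma\,|\,P)$ the active substitution $\sigma$ (of finite domain, none of its domain variables being among $\vec x$) is idempotent and $\mathrm{dom}(\sigma)\cap \mathrm{fv}(P)=\emptyset$. A process $P$ is identified with $\mathrm{id}\,|\,P$. Parallel composition extends to extended processes by bringing restrictions to the front and joining active substitutions; $\rho\,|\,A$ joins $\rho$ to the active substitution of $A$. Substitution is capture-avoiding; $A\sigma$ acts on the range of the active substitution and on the process of $A$. Labels are $\pi ::= \tau\mid \overline M(x)\mid M\,N$, with $\mathrm{bn}(\overline M(x))=\{x\}$, $\mathrm{n}(\overline M(x))=\mathrm{fv}(M)\cup\{x\}$, $\mathrm{n}(M\,N)=\mathrm{fv}(M)\cup\mathrm{fv}(N)$,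 and $\mathrm{bn}$, $\mathrm n$ empty otherwise. A substitution $\sigma$ is *fresh for* a set $V$ of variables if $\mathrm{dom}(\sigma)\cap V=\emptyset$ and $\mathrm{fv}(y\sigma)\cap V=\emptyset$ for all $y\notin V$. Write $V\vDash M\neq N$ if no $\sigma$ fresh for $V$ has $M\sigma=_E N\sigma$. **Transitions** $V: A\xrightarrow{\pi}B$ ($V$ a finite set of variables) are given inductively by: * $V: M(x).P\xrightarrow{K\,N}P\{N/x\}$ if $M=_E K$; and $V:\overline M\langle N\rangle.P\xrightarrow{\overline K(x)}\{N/x\}\,|\,P$ if $M=_EK$ and $x\notin \mathrm{fv}(M,K,N,P)\cup V$; * if $V:P\xrightarrow{\pi}A$, then $P+Q$ and $Q+P$ have this transition, $[M=N]P$ has it if $M=_EN$, and $[M\neq N]P$ has it if $V\vDash M\neq N$; * if $V\cup\{x\}:A\xrightarrow{\pi}B$ and $x\notin \mathrm n(\pi)\cup V$, then $V:\nu x.A\xrightarrow{\pi}\nu x.B$ (for processes and extended processes); * if $V:P\xrightarrow{\pi}A$ and $\mathrm{bn}(\pi)\cap \mathrm{fv}(Q)=\emptyset$, then $V:P\,|\,Q\xrightarrow{\pi}A\,|\,Q$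 and $V:Q\,|\,P\xrightarrow{\pi}Q\,|\,A$; if $V:P\xrightarrow{\pi}A$ and $\mathrm{bn}(\pi)\cap\mathrm{fv}(P)=\emptyset$, then $V:\;!P\xrightarrow{\pi}A\,|\,!P$; * if $V:P\xrightarrow{\pi\sigma}A$ and $\sigma$ is fresh for $\mathrm{bn}(\pi)$, then $V:\sigma\,|\,P\xrightarrow{\pi}\sigma\,|\,A$; * if $V:P\xrightarrow{\overline M(x)}\nu\vec z.(\{N/x\}\,|\,P')$ and $V:Q\xrightarrow{K\,N}Q'$ with $M=_EK$ and $(\{x\}\cup\vec z)\cap \mathrm{fv}(Q)=\emptyset$, then $V:P\,|\,Q\xrightarrow{\tau}\nu\vec z.(P'\,|\,Q')$, and symmetrically; * if $V:P\xrightarrow{\overline M(x)}\nu\vec z.(\{N/x\}\,|\,Q)$ and $V:P\xrightarrow{K\,N}R$ with $M=_EK$ and $\vec z\cap \mathrm{fv}(P)=\emptyset$, then $V:\;!P\xrightarrow{\tau}\nu\vec z.(Q\,|\,R\,|\,!P)$. Write $A\xrightarrow{\pi}B$ for $\emptyset:A\xrightarrow{\pi}B$. **Reachability.** For $A=\nu\vec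 x.(\theta\,|\,P)$ write $A\le_{\sigma,\nu\vec z.\rho}B$ if $\sigma$ and $\rho$ are idempotent and fresh for $\mathrm{dom}(\theta)$, $\vec z\cap(\mathrm{dom}(\rho)\cup\mathrm{dom}(\theta))=\emptyset$, and $B=\nu\vec z.(\rho\,|\,A\sigma\rho)$. **Quasi-open bisimilarity.** $\nu\vec x.(\sigma\,|\,P)$ and $\nu\vec y.(\theta\,|\,Q)$ are *statically equivalent* if $M\sigma=_EN\sigma\iff M\theta=_EN\theta$ for all messages $M,N$ not mentioning $\vec x,\vec y$. A symmetric relation $\mathcal R$ on extended processes is a *quasi-open bisimulation* if it is open ($A\mathrel{\mathcal R}B$, $A\le_{\sigma,\nu\vec z.\rho}A'$ and $B\le_{\sigma,\nu\vec z.\rho}B'$ imply $A'\mathrel{\mathcal R}B'$) and $A\mathrel{\mathcal R}B$ implies that $A,B$ are statically equivalent and that, whenever $A\xrightarrow{\pi}A'$ (with $\mathrm{bn}(\pi)$ fresh for $A$ and $B$), there is $B'$ with $B\xrightarrow{\pi}B'$ and $A'\mathrel{\mathcal R}B'$. *Quasi-open bisimilarity* $\sim$ is the greatest quasi-open bisimulation.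 **The logic.** Formulae of intuitionistic $\mathcal{FM}$ are $$\phi ::= \mathtt{tt}\mid\mathtt{ff}\mid M=N\mid\phi\wedge\phi\mid\phi\vee\phi\mid\phi\supset\phi\mid\langle\pi\rangle\phi\mid[\pi]\phi,$$ taken up to $\alpha$-conversion, where $x$ is bound in $\phi$ in $\langle\overline M(x)\rangle\phi$ and $[\overline M(x)]\phi$. In the modal clauses of satisfaction the bound name of $\pi$ is chosen fresh. $A\vDash\mathtt{tt}$ always and $A\vDash\mathtt{ff}$ never; $\wedge,\vee$ are read as usual; * $\nu\vec x.(\sigma\,|\,P)\vDash M=N$ iff $M\sigma=_EN\sigma$ and $\vec x\cap(\mathrm{fv}(M)\cup\mathrm{fv}(N))=\emptyset$ ($\vec x$ being renamed apart from $M,N$); * $A\vDash\phi_1\supset\phi_2$ iff whenever $A\le_{\sigma,\nu\vec z.\rho}A'$, $A'\vDash\phi_1\sigma$ implies $A'\vDash\phi_2\sigma$; * $A\vDash\langle\pi\rangle\phi$ iff there is $B$ with $A\xrightarrow{\pi}B$ and $B\vDash\phi$; * $A\vDash[\pi]\phi$ iff whenever $A\le_{\sigma,\nu\vec z.\rho}A'$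 and $A'\xrightarrow{\pi\sigma}B$, then $B\vDash\phi\sigma$. **Theorem 4.1 (soundness).** Let $P$ and $Q$ be processes with $P\sim Q$. Then for every formula $\phi$ of intuitionistic $\mathcal{FM}$, $P\vDash\phi$ if and only if $Q\vDash\phi$. -/

import Mathlib

namespace AppliedPi

universe u

/-! Messages.  Names are variables; free variables are natural numbers, and bound variables
are de Bruijn indices, so that objects are identified up to alpha-conversion. -/

/-- An arbitrary message language: function symbols with their arities. -/
structure Sig where
  Op : Type u
  ar : Op → ℕ

/-- Messages with variables in `X`. -/
inductive Tm (S : Sig.{u}) (X : Type) : Type u where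
  | var : X → Tm S X
  | app : (f : S.Op) → (Fin (S.ar f) → Tm S X) → Tm S X

/-- Simultaneous substitution in a message. -/
def Tm.bind {S : Sig.{u}} {X Y : Type} (g : X → Tm S Y) : Tm S X → Tm S Y
  | .var x => g x
  | .app f ts => .app f (fun i => (ts i).bind g)

/-- The equational theory `=_E` generated by an arbitrary set `E` of axioms: the least congruence
containing all substitution instances of the axioms. -/
inductive EqE {S : Sig.{u}} (E : Set (Tm S ℕ × Tm S ℕ)) {X : Type} : Tm S X → Tm S X → Prop where
  | ax {M N : Tm S ℕ} (h : (M, N) ∈ E) (g : ℕ → Tm S X) : EqE E (M.bind g) (N.bind g)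
  | refl (M : Tm S X) : EqE E M M
  | symm {M N : Tm S X} : EqE E M N → EqE E N M
  | trans {M N K : Tm S X} : EqE E M N → EqE E N K → EqE E M K
  | congr (f : S.Op) {ts us : Fin (S.ar f) → Tm S X} :
      (∀ i, EqE E (ts i) (us i)) → EqE E (.app f ts) (.app f us)

/-- Variables below `n` binders: a free variable, or one of the `n` bound variables
(index `0` belongs to the innermost binder). -/
abbrev Vr (n : ℕ) : Type := ℕ ⊕ Fin n

/-- Messages below `n` binders.  Messages proper are `Msg S 0`. -/
abbrev Msg (S : Sig.{u}) (n : ℕ) : Type u := Tm S (Vr n)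

/-- The free variables `fv(M)` of a message. -/
def Msg.fv {S : Sig.{u}} {n : ℕ} : Msg S n → Finset ℕ
  | .var (.inl x) => {x}
  | .var (.inr _) => ∅
  | .app _ ts => Finset.univ.biUnion (fun i => Msg.fv (ts i))

/-- Renaming of variables in a message. -/
def Msg.rename {S : Sig.{u}} {n m : ℕ} (r : Vr n → Vr m) (M : Msg S n) : Msg S m :=
  M.bind (fun v => .var (r v))

/-- Regard a variable outside all binders as one below `n` binders. -/
def weaken (n : ℕ) : Vr 0 → Vr n := Sum.map id (fun i => i.elim0)

/-- Bind the free variable `x` by a new outermost binder. -/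
def closeVar (x : ℕ) {n : ℕ} : Vr n → Vr (n + 1)
  | .inl y => if y = x then .inr (Fin.last n) else .inl y
  | .inr i => .inr i.castSucc

/-- A simultaneous substitution below one more binder. -/
def lift {S : Sig.{u}} {n m : ℕ} (g : Vr n → Msg S m) : Vr (n + 1) → Msg S (m + 1)
  | .inl y => (g (.inl y)).rename (Sum.map id Fin.succ)
  | .inr i => Fin.cases (.var (.inr 0))
      (fun j => (g (.inr j)).rename (Sum.map id Fin.succ)) i

/-! Substitutions of finite domain. -/

/-- A substitution with finite domain, from free variables to messages below `n` binders. -/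
structure Sub (S : Sig.{u}) (n : ℕ) where
  map : ℕ → Option (Msg S n)
  dom : Finset ℕ
  mem_dom : ∀ x, x ∈ dom ↔ (map x).isSome

namespace Sub

variable {S : Sig.{u}} {n m : ℕ}

/-- `yσ`, where `y` is a variable: variables outside the domain are left alone. -/
def app (σ : Sub S n) (y : ℕ) : Msg S n := (σ.map y).getD (.var (.inl y))

/-- The action of a substitution on all variables below `n` binders. -/
def fn (σ : Sub S n) : Vr n → Msg S n
  | .inl y => σ.app y
  | .inr i => .var (.inr i)

/-- The identity substitution. -/
def id : Sub S n := ⟨fun _ => none, ∅, by simp⟩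

/-- The substitution `{N/x}`. -/
def single (x : ℕ) (N : Msg S n) : Sub S n :=
  ⟨fun y => if y = x then some N else none, {x}, by intro y; by_cases h : y = x <;> simp [h]⟩

/-- Apply `g` to all messages in the range; the domain does not change. -/
def mapRange (σ : Sub S n) (g : Msg S n → Msg S m) : Sub S m :=
  ⟨fun x => (σ.map x).map g, σ.dom, by intro x; simp [σ.mem_dom]⟩

/-- The join `σ·θ`, used for substitutions of disjoint domains. -/
def join (σ θ : Sub S n) : Sub S n :=
  ⟨fun x => (σ.map x).or (θ.map x), σ.dom ∪ θ.dom, by intro x; simp [σ.mem_dom, θ.mem_dom]⟩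

/-- A substitution regarded as one below `k` binders. -/
def up (k : ℕ) (σ : Sub S 0) : Sub S k := σ.mapRange (Msg.rename (weaken k))

/-- `σ` is fresh for the set of variables `V`. -/
def Fresh (σ : Sub S 0) (V : Finset ℕ) : Prop :=
  Disjoint σ.dom V ∧ ∀ y, y ∉ V → Disjoint (Msg.fv (σ.app y)) V

/-- `σ` is idempotent: the variables of its domain do not occur in any `yσ`. -/
def Idem (σ : Sub S n) : Prop := ∀ y, Disjoint σ.dom (Msg.fv (σ.app y))

end Sub

/-- `Mσ`, for a message `M` whose variables are all free and a substitution below `k` binders. -/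
def Msg.sub {S : Sig.{u}} {k : ℕ} (M : Msg S 0) (σ : Sub S k) : Msg S k :=
  (M.rename (weaken k)).bind σ.fn

/-- Entailment `V ⊨ M ≠ N`. -/
def EntailsNe {S : Sig.{u}} (E : Set (Tm S ℕ × Tm S ℕ)) (V : Finset ℕ) (M N : Msg S 0) : Prop :=
  ¬ ∃ σ : Sub S 0, σ.Fresh V ∧ EqE E (M.sub σ) (N.sub σ)

/-! Processes and extended processes. -/

/-- Processes below `n` binders.  Processes proper are `Proc S 0`. -/
inductive Proc (S : Sig.{u}) : ℕ → Type u where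
  | nil {n : ℕ} : Proc S n
  | out {n : ℕ} : Msg S n → Msg S n → Proc S n → Proc S n
  | inp {n : ℕ} : Msg S n → Proc S (n + 1) → Proc S n
  | mat {n : ℕ} : Msg S n → Msg S n → Proc S n → Proc S n
  | mismat {n : ℕ} : Msg S n → Msg S n → Proc S n → Proc S n
  | new {n : ℕ} : Proc S (n + 1) → Proc S n
  | par {n : ℕ} : Proc S n → Proc S n → Proc S n
  | sum {n : ℕ} : Proc S n → Proc S n → Proc S n
  | rep {n : ℕ} : Proc S n → Proc S n

namespace Proc

variable {S : Sig.{u}}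

/-- Capture-avoiding simultaneous substitution. -/
def bind : {n m : ℕ} → (Vr n → Msg S m) → Proc S n → Proc S m
  | _, _, _, .nil => .nil
  | _, _, g, .out M N P => .out (Tm.bind g M) (Tm.bind g N) (P.bind g)
  | _, _, g, .inp M P => .inp (Tm.bind g M) (P.bind (lift g))
  | _, _, g, .mat M N P => .mat (Tm.bind g M) (Tm.bind g N) (P.bind g)
  | _, _, g, .mismat M N P => .mismat (Tm.bind g M) (Tm.bind g N) (P.bind g)
  | _, _, g, .new P => .new (P.bind (lift g))
  | _, _, g, .par P Q => .par (P.bind g) (Q.bind g)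
  | _, _, g, .sum P Q => .sum (P.bind g) (Q.bind g)
  | _, _, g, .rep P => .rep (P.bind g)

/-- Renaming of variables in a process. -/
def rename {n m : ℕ} (r : Vr n → Vr m) (P : Proc S n) : Proc S m := P.bind (fun v => .var (r v))

/-- The free variables of a process. -/
def fv : {n : ℕ} → Proc S n → Finset ℕ
  | _, .nil => ∅
  | _, .out M N P => Msg.fv M ∪ Msg.fv N ∪ P.fv
  | _, .inp M P => Msg.fv M ∪ P.fv
  | _, .mat M N P => Msg.fv M ∪ Msg.fv N ∪ P.fv
  | _, .mismat M N P => Msg.fv M ∪ Msg.fv N ∪ P.fv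
  | _, .new P => P.fv
  | _, .par P Q => P.fv ∪ Q.fv
  | _, .sum P Q => P.fv ∪ Q.fv
  | _, .rep P => P.fv

/-- The input process `M(x).P`, in which `x` is bound in `P`. -/
def recv (M : Msg S 0) (x : ℕ) (P : Proc S 0) : Proc S 0 := .inp M (P.rename (closeVar x))

/-- The process `νx.P`, in which `x` is bound in `P`. -/
def nu (x : ℕ) (P : Proc S 0) : Proc S 0 := .new (P.rename (closeVar x))

end Proc

/-- Extended processes `νx₁.…νxₖ.(σ | P)` up to alpha-conversion; the `k` restricted names are the
bound variables of `σ` and `P`, and `dom σ` consists of free variables. -/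
structure Ext (S : Sig.{u}) where
  k : ℕ
  act : Sub S k
  proc : Proc S k

namespace Ext

variable {S : Sig.{u}}

/-- The domain of the active substitution of an extended process. -/
def dom (A : Ext S) : Finset ℕ := A.act.dom

/-- The free variables of an extended process, including the domain of its substitution. -/
def fv (A : Ext S) : Finset ℕ :=
  A.dom ∪ A.dom.biUnion (fun x => Msg.fv (A.act.app x)) ∪ A.proc.fv

/-- The normal form restriction: `σ` is idempotent and fully applied to `P`. -/
def NF (A : Ext S) : Prop := A.act.Idem ∧ Disjoint A.dom A.proc.fv

/-- A process as an extended process, with the identity as its active substitution. -/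
def ofProc (P : Proc S 0) : Ext S := ⟨0, Sub.id, P⟩

/-- The extended process `νx.A`, in which `x` is bound in `A`, for `x ∉ dom A`. -/
def nu (x : ℕ) (A : Ext S) : Ext S :=
  ⟨A.k + 1, A.act.mapRange (Msg.rename (closeVar x)), A.proc.rename (closeVar x)⟩

/-- The extended process `νx₁.…νxₙ.A`. -/
def nus (xs : List ℕ) (A : Ext S) : Ext S := xs.foldr nu A

/-- The parallel composition `A | B`: restricted names are brought to the front, those of `A`
outermost. -/
def par (A B : Ext S) : Ext S :=
  let l : Vr A.k → Vr (B.k + A.k) := Sum.map id (Fin.natAdd B.k)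
  let r : Vr B.k → Vr (B.k + A.k) := Sum.map id (Fin.castAdd A.k)
  ⟨B.k + A.k, (A.act.mapRange (Msg.rename l)).join (B.act.mapRange (Msg.rename r)),
    .par (A.proc.rename l) (B.proc.rename r)⟩

/-- The composition `ρ | A` of a substitution with an extended process. -/
def withSub (ρ : Sub S 0) (A : Ext S) : Ext S := ⟨A.k, (ρ.up A.k).join A.act, A.proc⟩

/-- `Aσ`: capture-avoiding substitution in an extended process. -/
def sub (A : Ext S) (σ : Sub S 0) : Ext S :=
  ⟨A.k, A.act.mapRange (Tm.bind (σ.up A.k).fn), A.proc.bind (σ.up A.k).fn⟩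

end Ext

/-! The open early labelled transition system. -/

/-- Labels: `τ`, bound output on channel `M` binding `x`, and free input of `N` on channel `M`. -/
inductive Lab (S : Sig.{u}) : Type u where
  | tau : Lab S
  | out (M : Msg S 0) (x : ℕ) : Lab S
  | inp (M N : Msg S 0) : Lab S

namespace Lab

variable {S : Sig.{u}}

/-- The bound names of a label. -/
def bn : Lab S → Finset ℕ
  | .tau => ∅
  | .out _ x => {x}
  | .inp _ _ => ∅

/-- The names of a label. -/
def names : Lab S → Finset ℕ
  | .tau => ∅
  | .out M x => Msg.fv M ∪ {x}
  | .inp M N => Msg.fv M ∪ Msg.fv N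

/-- `πσ`; used only for `σ` fresh for the bound names of `π`. -/
def sub (σ : Sub S 0) : Lab S → Lab S
  | .tau => .tau
  | .out M x => .out (M.sub σ) x
  | .inp M N => .inp (M.sub σ) (N.sub σ)

end Lab

/-- Transitions `V : P —π→ A` from processes.  The equational theory may be applied to the channels
and to the two sides of a match. -/
inductive PTrans {S : Sig.{u}} (E : Set (Tm S ℕ × Tm S ℕ)) :
    Finset ℕ → Proc S 0 → Lab S → Ext S → Prop where
  | inp {V : Finset ℕ} {M K N : Msg S 0} {x : ℕ} {P : Proc S 0} :
      EqE E M K →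
      PTrans E V (.recv M x P) (.inp K N) (.ofProc (P.bind (Sub.single x N).fn))
  | out {V : Finset ℕ} {M K N : Msg S 0} {x : ℕ} {P : Proc S 0} :
      EqE E M K → x ∉ Msg.fv M ∪ Msg.fv K ∪ Msg.fv N ∪ P.fv ∪ V →
      PTrans E V (.out M N P) (.out K x) ⟨0, Sub.single x N, P⟩
  | sumL {V : Finset ℕ} {P Q : Proc S 0} {π : Lab S} {A : Ext S} :
      PTrans E V P π A → PTrans E V (.sum P Q) π A
  | sumR {V : Finset ℕ} {P Q : Proc S 0} {π : Lab S} {A : Ext S} :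
      PTrans E V Q π A → PTrans E V (.sum P Q) π A
  | mat {V : Finset ℕ} {M N : Msg S 0} {P : Proc S 0} {π : Lab S} {A : Ext S} :
      EqE E M N → PTrans E V P π A → PTrans E V (.mat M N P) π A
  | mismat {V : Finset ℕ} {M N : Msg S 0} {P : Proc S 0} {π : Lab S} {A : Ext S} :
      PTrans E V P π A → EntailsNe E V M N → PTrans E V (.mismat M N P) π A
  | res {V : Finset ℕ} {x : ℕ} {P : Proc S 0} {π : Lab S} {B : Ext S} :
      PTrans E (insert x V) P π B → x ∉ π.names ∪ V →
      PTrans E V (.nu x P) π (.nu x B)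
  | parL {V : Finset ℕ} {P Q : Proc S 0} {π : Lab S} {A : Ext S} :
      PTrans E V P π A → Disjoint π.bn Q.fv →
      PTrans E V (.par P Q) π (.par A (.ofProc Q))
  | parR {V : Finset ℕ} {P Q : Proc S 0} {π : Lab S} {A : Ext S} :
      PTrans E V Q π A → Disjoint π.bn P.fv →
      PTrans E V (.par P Q) π (.par (.ofProc P) A)
  | repAct {V : Finset ℕ} {P : Proc S 0} {π : Lab S} {A : Ext S} :
      PTrans E V P π A → Disjoint π.bn P.fv →
      PTrans E V (.rep P) π (.par A (.ofProc (.rep P)))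
  | closeL {V : Finset ℕ} {P Q P' : Proc S 0} {M K N : Msg S 0} {x : ℕ} {zs : List ℕ}
      {Q' : Ext S} :
      PTrans E V P (.out M x) (.nus zs ⟨0, Sub.single x N, P'⟩) →
      PTrans E V Q (.inp K N) Q' → EqE E M K →
      x ∉ Q.fv → (∀ z ∈ zs, z ≠ x ∧ z ∉ Q.fv) →
      PTrans E V (.par P Q) .tau (.nus zs (.par (.ofProc P') Q'))
  | closeR {V : Finset ℕ} {P Q Q' : Proc S 0} {M K N : Msg S 0} {x : ℕ} {zs : List ℕ}
      {P' : Ext S} :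
      PTrans E V Q (.out M x) (.nus zs ⟨0, Sub.single x N, Q'⟩) →
      PTrans E V P (.inp K N) P' → EqE E M K →
      x ∉ P.fv → (∀ z ∈ zs, z ≠ x ∧ z ∉ P.fv) →
      PTrans E V (.par P Q) .tau (.nus zs (.par P' (.ofProc Q')))
  | repClose {V : Finset ℕ} {P Q : Proc S 0} {M K N : Msg S 0} {x : ℕ} {zs : List ℕ}
      {R : Ext S} :
      PTrans E V P (.out M x) (.nus zs ⟨0, Sub.single x N, Q⟩) →
      PTrans E V P (.inp K N) R → EqE E M K →
      (∀ z ∈ zs, z ≠ x ∧ z ∉ P.fv) →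
      PTrans E V (.rep P) .tau (.nus zs (.par (.par (.ofProc Q) R) (.ofProc (.rep P))))

/-- Transitions `V : A —π→ B` between extended processes. -/
inductive Trans {S : Sig.{u}} (E : Set (Tm S ℕ × Tm S ℕ)) :
    Finset ℕ → Ext S → Lab S → Ext S → Prop where
  | active {V : Finset ℕ} {σ : Sub S 0} {P : Proc S 0} {π : Lab S} {A : Ext S} :
      PTrans E V P (π.sub σ) A → σ.Fresh π.bn →
      Trans E V ⟨0, σ, P⟩ π (.withSub σ A)
  | res {V : Finset ℕ} {x : ℕ} {A B : Ext S} {π : Lab S} :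
      Trans E (insert x V) A π B → x ∉ π.names ∪ V → x ∉ A.dom →
      Trans E V (.nu x A) π (.nu x B)

/-! Quasi-open bisimilarity. -/

/-- Static equivalence.  Messages proper have free variables only, so they cannot mention the
restricted names of `A` and `B`. -/
def StaticEq {S : Sig.{u}} (E : Set (Tm S ℕ × Tm S ℕ)) (A B : Ext S) : Prop :=
  ∀ M N : Msg S 0, EqE E (M.sub A.act) (N.sub A.act) ↔ EqE E (M.sub B.act) (N.sub B.act)

/-- Reachability: `A` can reach `B` by the substitution `σ` and the environment extension
`νz₁.…νzₙ.ρ`. -/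
def Reach {S : Sig.{u}} (A : Ext S) (σ : Sub S 0) (zs : List ℕ) (ρ : Sub S 0) (B : Ext S) : Prop :=
  σ.Idem ∧ ρ.Idem ∧ σ.Fresh A.dom ∧ ρ.Fresh A.dom ∧ (∀ z ∈ zs, z ∉ ρ.dom ∪ A.dom) ∧
    B = Ext.nus zs (Ext.withSub ρ ((A.sub σ).sub ρ))

/-- A relation is open if it is preserved by reachability. -/
def IsOpenRel {S : Sig.{u}} (R : Ext S → Ext S → Prop) : Prop :=
  ∀ A B A' B' σ zs ρ, R A B → Reach A σ zs ρ A' → Reach B σ zs ρ B' → R A' B'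

/-- Quasi-open bisimulations between extended processes in normal form.  As usual, the bound name
of an output label is taken fresh for both extended processes. -/
structure IsQuasiOpenBisim {S : Sig.{u}} (E : Set (Tm S ℕ × Tm S ℕ))
    (R : Ext S → Ext S → Prop) : Prop where
  nf : ∀ A B, R A B → A.NF ∧ B.NF
  symm : ∀ A B, R A B → R B A
  isOpen : IsOpenRel R
  static : ∀ A B, R A B → StaticEq E A B
  step : ∀ A B π A', R A B → Disjoint π.bn (A.fv ∪ B.fv) → Trans E ∅ A π A' →
    ∃ B', Trans E ∅ B π B' ∧ R A' B'

/-- Quasi-open bisimilarity, the union of all quasi-open bisimulations. -/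
def QuasiOpenBisimilar {S : Sig.{u}} (E : Set (Tm S ℕ × Tm S ℕ)) (A B : Ext S) : Prop :=
  ∃ R : Ext S → Ext S → Prop, IsQuasiOpenBisim E R ∧ R A B

/-! The intuitionistic modal logic. -/

/-- Formulae below `n` binders.  Formulae proper are `Form S 0`.  The modalities for bound output
bind a variable in the formula that follows. -/
inductive Form (S : Sig.{u}) : ℕ → Type u where
  | tt {n : ℕ} : Form S n
  | ff {n : ℕ} : Form S n
  | eq {n : ℕ} : Msg S n → Msg S n → Form S n
  | and {n : ℕ} : Form S n → Form S n → Form S n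
  | or {n : ℕ} : Form S n → Form S n → Form S n
  | imp {n : ℕ} : Form S n → Form S n → Form S n
  | diaTau {n : ℕ} : Form S n → Form S n
  | diaOut {n : ℕ} : Msg S n → Form S (n + 1) → Form S n
  | diaInp {n : ℕ} : Msg S n → Msg S n → Form S n → Form S n
  | boxTau {n : ℕ} : Form S n → Form S n
  | boxOut {n : ℕ} : Msg S n → Form S (n + 1) → Form S n
  | boxInp {n : ℕ} : Msg S n → Msg S n → Form S n → Form S n

namespace Form

variable {S : Sig.{u}}

/-- Capture-avoiding simultaneous substitution. -/
def bind : {n m : ℕ} → (Vr n → Msg S m) → Form S n → Form S m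
  | _, _, _, .tt => .tt
  | _, _, _, .ff => .ff
  | _, _, g, .eq M N => .eq (Tm.bind g M) (Tm.bind g N)
  | _, _, g, .and φ ψ => .and (φ.bind g) (ψ.bind g)
  | _, _, g, .or φ ψ => .or (φ.bind g) (ψ.bind g)
  | _, _, g, .imp φ ψ => .imp (φ.bind g) (ψ.bind g)
  | _, _, g, .diaTau φ => .diaTau (φ.bind g)
  | _, _, g, .diaOut M φ => .diaOut (Tm.bind g M) (φ.bind (lift g))
  | _, _, g, .diaInp M N φ => .diaInp (Tm.bind g M) (Tm.bind g N) (φ.bind g)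
  | _, _, g, .boxTau φ => .boxTau (φ.bind g)
  | _, _, g, .boxOut M φ => .boxOut (Tm.bind g M) (φ.bind (lift g))
  | _, _, g, .boxInp M N φ => .boxInp (Tm.bind g M) (Tm.bind g N) (φ.bind g)

/-- `φσ` below `n` binders. -/
def sub {n : ℕ} (φ : Form S n) (σ : Sub S 0) : Form S n := φ.bind (σ.up n).fn

/-- Name the variable bound by a modality `z`. -/
def inst (φ : Form S 1) (z : ℕ) : Form S 0 :=
  φ.bind (Sum.elim (fun y => .var (.inl y)) (fun _ => .var (.inl z)))

/-- The height of a formula, on which satisfaction is defined by recursion. -/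
def height : {n : ℕ} → Form S n → ℕ
  | _, .tt => 0
  | _, .ff => 0
  | _, .eq _ _ => 0
  | _, .and φ ψ => max φ.height ψ.height + 1
  | _, .or φ ψ => max φ.height ψ.height + 1
  | _, .imp φ ψ => max φ.height ψ.height + 1
  | _, .diaTau φ => φ.height + 1
  | _, .diaOut _ φ => φ.height + 1
  | _, .diaInp _ _ φ => φ.height + 1
  | _, .boxTau φ => φ.height + 1
  | _, .boxOut _ φ => φ.height + 1
  | _, .boxInp _ _ φ => φ.height + 1

theorem height_bind {n m : ℕ} (g : Vr n → Msg S m) (φ : Form S n) :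
    (φ.bind g).height = φ.height := by
  induction φ generalizing m <;> simp_all [bind, height]

theorem height_sub {n : ℕ} (φ : Form S n) (σ : Sub S 0) : (φ.sub σ).height = φ.height :=
  height_bind _ _

theorem height_inst (φ : Form S 1) (z : ℕ) : (φ.inst z).height = φ.height :=
  height_bind _ _

end Form

/-- Satisfaction `A ⊨ φ`.  In the modalities for bound output, `∃ L, ∀ z ∉ L` says that the bound
variable is named by a fresh `z`: the clause is required of all but finitely many `z`. -/
def Sat {S : Sig.{u}} (E : Set (Tm S ℕ × Tm S ℕ)) : Ext S → Form S 0 → Prop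
  | _, .tt => True
  | _, .ff => False
  | A, .eq M N => EqE E (M.sub A.act) (N.sub A.act)
  | A, .and φ ψ => Sat E A φ ∧ Sat E A ψ
  | A, .or φ ψ => Sat E A φ ∨ Sat E A ψ
  | A, .imp φ ψ => ∀ σ zs ρ A', Reach A σ zs ρ A' → Sat E A' (φ.sub σ) → Sat E A' (ψ.sub σ)
  | A, .diaTau φ => ∃ B, Trans E ∅ A .tau B ∧ Sat E B φ
  | A, .diaOut M φ => ∃ L : Finset ℕ, ∀ z, z ∉ L →
      ∃ B, Trans E ∅ A (.out M z) B ∧ Sat E B (φ.inst z)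
  | A, .diaInp M N φ => ∃ B, Trans E ∅ A (.inp M N) B ∧ Sat E B φ
  | A, .boxTau φ => ∀ σ zs ρ A', Reach A σ zs ρ A' →
      ∀ B, Trans E ∅ A' .tau B → Sat E B (φ.sub σ)
  | A, .boxOut M φ => ∀ σ zs ρ A', Reach A σ zs ρ A' → ∃ L : Finset ℕ, ∀ z, z ∉ L →
      ∀ B, Trans E ∅ A' (.out (M.sub σ) z) B → Sat E B ((φ.sub σ).inst z)
  | A, .boxInp M N φ => ∀ σ zs ρ A', Reach A σ zs ρ A' →
      ∀ B, Trans E ∅ A' (.inp (M.sub σ) (N.sub σ)) B → Sat E B (φ.sub σ)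
  termination_by _ φ => φ.height
  decreasing_by all_goals simp only [Form.height, Form.height_sub, Form.height_inst]; omega

end AppliedPi

namespace AppliedPi

universe v

variable {S : Sig.{v}} {E : Set (Tm S ℕ × Tm S ℕ)}

/-! ### Domains of active substitutions -/

namespace Ext

/-! Satisfaction is transported along a bisimulation `R` by induction on the formula. Equations are
settled by static equivalence, diamonds by the transfer of steps. The intuitionistic clauses
(implication and boxes) start from something reached by `B`: the same move must be made by `A`,
openness relates the two results, and symmetry carries premises, or steps, back to the side of `A`.

The one obstacle is that `A` may be unable to make the move. Its side conditions refer to the domain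
of the source, and neither openness nor static equivalence as defined forces related pairs to have
equal domains. However, reachability and transitions change the domain in a way fixed by the data
`ρ` and the label alone (`Reach.dom_eq`, `Trans.dom_eq`). So the pairs of `R` with equal domains
again form a bisimulation (`restrict_dom`), and it contains the initial pair because plain processes
have empty domain. On it `reach` supplies the missing move, and the induction in `sat` goes through.
-/

@[simp] theorem dom_ofProc (P : Proc S 0) : (ofProc P).dom = ∅ := rfl

@[simp] theorem dom_nu (x : ℕ) (A : Ext S) : (nu x A).dom = A.dom := rfl

@[simp] theorem dom_nus (xs : List ℕ) (A : Ext S) : (nus xs A).dom = A.dom := by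
  induction xs with
  | nil => rfl
  | cons x xs ih => exact ih

@[simp] theorem dom_par (A B : Ext S) : (par A B).dom = A.dom ∪ B.dom := rfl

@[simp] theorem dom_withSub (ρ : Sub S 0) (A : Ext S) : (withSub ρ A).dom = ρ.dom ∪ A.dom := rfl

@[simp] theorem dom_sub (A : Ext S) (σ : Sub S 0) : (A.sub σ).dom = A.dom := rfl

end Ext

@[simp] theorem Lab.bn_sub (σ : Sub S 0) (π : Lab S) : (π.sub σ).bn = π.bn := by
  cases π <;> rfl

/-- A transition from a process exports exactly the bound names of its label. -/
theorem PTrans.dom_eq {V : Finset ℕ} {P : Proc S 0} {π : Lab S} {A : Ext S}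
    (h : PTrans E V P π A) : A.dom = π.bn := by
  induction h with
  | inp | out => rfl
  | sumL _ ih | sumR _ ih | mat _ _ ih | mismat _ _ ih => exact ih
  | res _ _ ih => exact ih
  | parL _ _ ih | parR _ _ ih | repAct _ _ ih => simpa using ih
  -- Communication discards the exported `{N/x}`, so only the hypothesis for the input premise
  -- matters, and inputs export nothing.
  | closeL _ _ _ _ _ _ ih | closeR _ _ _ _ _ _ ih | repClose _ _ _ _ _ ih =>
    simpa [Lab.bn] using ih

/-- A transition adds the bound names of its label to the domain. -/
theorem Trans.dom_eq {V : Finset ℕ} {A B : Ext S} {π : Lab S}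
    (h : Trans E V A π B) : B.dom = A.dom ∪ π.bn := by
  induction h with
  | active h _ =>
    rw [Ext.dom_withSub, h.dom_eq, Lab.bn_sub]
    rfl
  | res _ _ _ ih => simpa using ih

/-- Substitution acts only on the range and restriction binds no domain variable, so only `ρ`
enlarges the domain. Equality of domains therefore survives a common move. -/
theorem Reach.dom_eq {A B : Ext S} {σ ρ : Sub S 0} {zs : List ℕ} (h : Reach A σ zs ρ B) :
    B.dom = ρ.dom ∪ A.dom := by
  obtain ⟨-, -, -, -, -, rfl⟩ := h
  simp

/-- The conditions on reachability depend only on the domain of the source. -/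
theorem Reach.exists_of_dom_eq {A B B' : Ext S} {σ ρ : Sub S 0} {zs : List ℕ}
    (h : Reach B σ zs ρ B') (hd : A.dom = B.dom) : ∃ A', Reach A σ zs ρ A' := by
  obtain ⟨h₁, h₂, h₃, h₄, h₅, -⟩ := h
  rw [← hd] at h₃ h₄ h₅
  exact ⟨_, h₁, h₂, h₃, h₄, h₅, rfl⟩

/-! ### Transporting satisfaction along a bisimulation -/

namespace IsQuasiOpenBisim

variable {R : Ext S → Ext S → Prop}

/-- The pairs of a quasi-open bisimulation with equal domains form a quasi-open bisimulation. -/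
theorem restrict_dom (hR : IsQuasiOpenBisim E R) :
    IsQuasiOpenBisim E fun A B => R A B ∧ A.dom = B.dom where
  nf A B h := hR.nf A B h.1
  symm A B h := ⟨hR.symm A B h.1, h.2.symm⟩
  isOpen A B A' B' σ zs ρ h hA hB :=
    ⟨hR.isOpen A B A' B' σ zs ρ h.1 hA hB, by rw [hA.dom_eq, hB.dom_eq, h.2]⟩
  static A B h := hR.static A B h.1
  step A B π A' h hπ t := by
    obtain ⟨B', t', h'⟩ := hR.step A B π A' h.1 hπ t
    exact ⟨B', t', h', by rw [t.dom_eq, t'.dom_eq, h.2]⟩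

/-- Whatever one of two related processes of equal domains reaches, the other reaches a related
process in the same way. -/
theorem reach (hR : IsQuasiOpenBisim E R) (hdom : ∀ A B, R A B → A.dom = B.dom)
    {A B B' : Ext S} {σ ρ : Sub S 0} {zs : List ℕ} (h : R A B) (hB : Reach B σ zs ρ B') :
    ∃ A', Reach A σ zs ρ A' ∧ R A' B' :=
  let ⟨A', hA⟩ := hB.exists_of_dom_eq (hdom A B h)
  ⟨A', hA, hR.isOpen A B A' B' σ zs ρ h hA hB⟩

/-- Satisfaction is preserved by a quasi-open bisimulation that relates equal domains only. -/
theorem sat (hR : IsQuasiOpenBisim E R) (hdom : ∀ A B, R A B → A.dom = B.dom)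
    (φ : Form S 0) {A B : Ext S} (h : R A B) (hA : Sat E A φ) : Sat E B φ := by
  -- Height rather than structure: the clauses recurse on substituted and instantiated subformulae.
  -- The pair must vary too, since it moves and, for implication, is swapped.
  induction hn : φ.height using Nat.strong_induction_on generalizing φ A B with
  | _ n ih =>
  subst hn
  have ih' : ∀ ψ : Form S 0, ψ.height < φ.height → ∀ {A B : Ext S}, R A B → Sat E A ψ →
      Sat E B ψ := fun ψ hψ _ _ h hA => ih _ hψ ψ h hA rfl
  clear ih
  cases φ with
  | tt => simp only [Sat]
  | ff => simp only [Sat] at hA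
  | eq M N =>
    simp only [Sat] at hA ⊢
    exact (hR.static A B h M N).1 hA
  | and φ ψ =>
    simp only [Sat] at hA ⊢
    exact ⟨ih' φ (by simp only [Form.height]; omega) h hA.1,
      ih' ψ (by simp only [Form.height]; omega) h hA.2⟩
  | or φ ψ =>
    simp only [Sat] at hA ⊢
    exact hA.imp (ih' φ (by simp only [Form.height]; omega) h)
      (ih' ψ (by simp only [Form.height]; omega) h)
  | imp φ ψ =>
    simp only [Sat] at hA ⊢
    intro σ zs ρ B' hB hφ
    obtain ⟨A', hA', h'⟩ := hR.reach hdom h hB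
    exact ih' _ (by simp only [Form.height, Form.height_sub]; omega) h'
      -- The antecedent travels from `B'` back to `A'` by symmetry; the consequent then returns to
      -- `B'`.
      (hA σ zs ρ A' hA' (ih' _ (by simp only [Form.height, Form.height_sub]; omega)
        (hR.symm _ _ h') hφ))
  | diaTau φ =>
    simp only [Sat] at hA ⊢
    obtain ⟨A', t, hA'⟩ := hA
    obtain ⟨B', t', h'⟩ := hR.step A B _ A' h (by exact Finset.disjoint_empty_left _) t
    exact ⟨B', t', ih' _ (by simp only [Form.height]; omega) h' hA'⟩
  | diaInp M N φ =>
    simp only [Sat] at hA ⊢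
    obtain ⟨A', t, hA'⟩ := hA
    obtain ⟨B', t', h'⟩ := hR.step A B _ A' h (by exact Finset.disjoint_empty_left _) t
    exact ⟨B', t', ih' _ (by simp only [Form.height]; omega) h' hA'⟩
  | diaOut M φ =>
    simp only [Sat] at hA ⊢
    obtain ⟨L, hL⟩ := hA
    -- Step transfer needs the bound name fresh for both processes; the cofinite reading of the
    -- modality lets their free variables be excluded as well.
    refine ⟨L ∪ (A.fv ∪ B.fv), fun z hz => ?_⟩
    obtain ⟨hzL, hz⟩ := Finset.notMem_union.1 hz
    obtain ⟨A', t, hA'⟩ := hL z hzL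
    obtain ⟨B', t', h'⟩ := hR.step A B _ A' h (by exact Finset.disjoint_singleton_left.2 hz) t
    exact ⟨B', t', ih' _ (by simp only [Form.height, Form.height_inst]; omega) h' hA'⟩
  | boxTau φ =>
    simp only [Sat] at hA ⊢
    intro σ zs ρ B' hB B'' t
    obtain ⟨A', hA', h'⟩ := hR.reach hdom h hB
    -- The step of `B'` is answered by `A'`, where the box hypothesis applies.
    obtain ⟨A'', t', h''⟩ :=
      hR.step B' A' _ B'' (hR.symm _ _ h') (by exact Finset.disjoint_empty_left _) t
    exact ih' _ (by simp only [Form.height, Form.height_sub]; omega) (hR.symm _ _ h'')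
      (hA σ zs ρ A' hA' A'' t')
  | boxInp M N φ =>
    simp only [Sat] at hA ⊢
    intro σ zs ρ B' hB B'' t
    obtain ⟨A', hA', h'⟩ := hR.reach hdom h hB
    obtain ⟨A'', t', h''⟩ :=
      hR.step B' A' _ B'' (hR.symm _ _ h') (by exact Finset.disjoint_empty_left _) t
    exact ih' _ (by simp only [Form.height, Form.height_sub]; omega) (hR.symm _ _ h'')
      (hA σ zs ρ A' hA' A'' t')
  | boxOut M φ =>
    simp only [Sat] at hA ⊢
    intro σ zs ρ B' hB
    obtain ⟨A', hA', h'⟩ := hR.reach hdom h hB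
    obtain ⟨L, hL⟩ := hA σ zs ρ A' hA'
    -- The excluded set may depend on the reached pair, since it is chosen after the move.
    refine ⟨L ∪ (B'.fv ∪ A'.fv), fun z hz B'' t => ?_⟩
    obtain ⟨hzL, hz⟩ := Finset.notMem_union.1 hz
    obtain ⟨A'', t', h''⟩ :=
      hR.step B' A' _ B'' (hR.symm _ _ h') (by exact Finset.disjoint_singleton_left.2 hz) t
    exact ih' _ (by simp only [Form.height, Form.height_sub, Form.height_inst]; omega)
      (hR.symm _ _ h'') (hL z hzL A'' t')

end IsQuasiOpenBisim

/-- Quasi-open bisimilar extended processes of equal domains satisfy the same formulae. -/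
theorem QuasiOpenBisimilar.sat_iff {A B : Ext S} (h : QuasiOpenBisimilar E A B)
    (hd : A.dom = B.dom) (φ : Form S 0) : Sat E A φ ↔ Sat E B φ := by
  obtain ⟨R, hR, hAB⟩ := h
  have hR' := hR.restrict_dom
  exact ⟨hR'.sat (fun _ _ h => h.2) φ ⟨hAB, hd⟩,
    hR'.sat (fun _ _ h => h.2) φ (hR'.symm _ _ ⟨hAB, hd⟩)⟩

end AppliedPi

theorem theorem4p1 {S : AppliedPi.Sig} (E : Set (AppliedPi.Tm S ℕ × AppliedPi.Tm S ℕ))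
    (P Q : AppliedPi.Proc S 0)
    (h : AppliedPi.QuasiOpenBisimilar E (AppliedPi.Ext.ofProc P) (AppliedPi.Ext.ofProc Q)) :
    ∀ φ : AppliedPi.Form S 0,
      AppliedPi.Sat E (AppliedPi.Ext.ofProc P) φ ↔ AppliedPi.Sat E (AppliedPi.Ext.ofProc Q) φ :=
  -- Both domains are empty.
  h.sat_iff rfl
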